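/- Let $A\colon H\supset\operatorname{dom}(A)\to H$ be a (possibly unbounded) linear operator on a separable complex Hilbert space $H$, with spectrum $\sigma(A)$. For an isolated point $s$ of $\sigma(A)$ let $P_{\{s\}}=\frac1{2\pi i}\oint (z-A)^{-1}dz$ be the Riesz projection (integral over a small circle around $s$), let $\operatorname{mult}(s)=\dim\operatorname{Image}(P_{\{s\}})$, and let the Riesz index of $s$ be the smallest integer $k\ge 1$ with $\operatorname{Ker}((s-A)^k)=\operatorname{Image}(P_{\{s\}})$. Assume: - (OP1) $A$ is closed; - (OP2) $\sigma(A)$ consists only of eigenvalues and has no accumulation point in $\mathbb C$; - (OP3) for every $s\in\sigma(A)$, $\operatorname{Image}(P_{\{s\}})$ is finite dimensional and the Riesz index of $s$ is $1$; - (OP4) $0<\operatorname{Re}(s)<1$ for all $s\in\sigma(A)$; - (OP5) (a) there is $s\in\sigma(A)$ with $\operatorname{Re}(s)<\frac12$ if and only if there is $s'\in\sigma(A)$ with $\operatorname{Re}(s')>\frac12$; (b) if $s\in\sigma(A)$, then $\bar s\in\sigma(A)$ and $\operatorname{mult}(\bar s)=\operatorname{mult}(s)$. Let $\mathscr F$ be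 the real algebra of all functions $\phi$ that are holomorphic on an open set containing the closed strip $0\le\operatorname{Re}(s)\le1$ and satisfy $\phi(\bar s)=\overline{\phi(s)}$ for $s\in\sigma(A)\cup\{0,1\}$; two functions that agree on the closed strip are identified. For $\phi\in\mathscr F$ and $n\ge0$ put $$\operatorname{tr}(\phi(A)^n)=\sum_{s\in\sigma(A),\ \phi(s)\ne0}\operatorname{mult}(s)\,\phi(s)^n$$ whenever this sum converges absolutely (the trace of the $n$-th power of $\phi(A)$ on the image of $\phi(A)$; for $n\ge1$ the condition $\phi(s)\neq0$ may be dropped). A family of cut-off functions is a family $(\phi_Y)_{Y>0}$ in $\mathscr F$ such that, with $q(Y):=\phi_Y(1)$, for each $Y>0$: $\phi_Y(0)=1$; $q(Y)\in(0,1)\cup(1,\infty)$; $\phi_Y(s)=q(Y)^s$ if $s\in\sigma(A)$ and $|\operatorname{Im}(s)|\le Y$; and $\phi_Y(s)=0$ if $s\in\sigma(A)$ and $|\operatorname{Im}(s)|>Y$. An abstract intersection theory for $A$ and $(\phi_Y)$ consists of a real vector space $V$, a bilinear form $\beta\colon V\times V\to\mathbb R$, nonzero vectors $v_{01},v_{10},h_a\in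 V$, a subalgebra $D$ of $\mathscr F$ (not necessarily containing $1$) with $\phi_Y\in D$ for all $Y>0$, a map $\tilde v_\delta\colon D\to V$, and a homomorphism of $\mathbb R$-algebras $\tilde\Phi\colon D\to\operatorname{End}_{\mathbb R}(V)$ (with $\tilde\Phi(1)=1$ if $1\in D$) such that, writing $v_\delta=\tilde v_\delta(\phi_Y)$, $\Phi=\tilde\Phi(\phi_Y)$, $q=q(Y)$ and $\langle x,y\rangle_V=\beta(x,v_{01})\beta(y,v_{10})+\beta(x,v_{10})\beta(y,v_{01})-\beta(x,y)$: - (INT1) $\beta$ is symmetric, $\beta(v_{01},v_{01})=\beta(v_{10},v_{10})=0$, $\beta(v_{01},v_{10})=1$, and for each $Y>0$: $\beta(\Phi^nv_\delta,v_{01})=1$ for all $n\ge0$, while $\beta(\Phi^nv_\delta,v_{10})=O(q^n)$ and $\beta(\Phi^nv_\delta,\Phi^nv_\delta)=O(q^n)$ as $n\to\infty$; - (INT2) for $x\in V$, if $\beta(x,h_a)=0$ then $\beta(x,x)\le0$; - (INT3) for all $\phi\in D$ and all $n\ge0$, $\operatorname{tr}(\phi(A)^n)$ is defined and $\operatorname{tr}(\phi(A)^n)=\langle\tilde\Phi(\phi)^n\tilde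 v_\delta(\phi),\tilde v_\delta(\phi)\rangle_V$. **Theorem.** Families of cut-off functions exist, and for every such family $(\phi_Y)_{Y>0}$ the following are equivalent: (i) the Riemann Hypothesis holds for $A$, i.e. $\operatorname{Re}(s)=\frac12$ for every $s\in\sigma(A)$; (ii) there exists an abstract intersection theory for $A$ and $(\phi_Y)_{Y>0}$. -/

import Mathlib

universe u w

open Filter Topology Asymptotics

noncomputable section

namespace AbsInt

section Operators

variable {H : Type*} [NormedAddCommGroup H] [InnerProductSpace ℂ H]

/-- `R` is a bounded two-sided inverse of `s - A : dom A → H`. -/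
def IsResolventAt (A : H →ₗ.[ℂ] H) (s : ℂ) (R : H →L[ℂ] H) : Prop :=
  (∀ y : H, ∃ h : R y ∈ A.domain, s • R y - A ⟨R y, h⟩ = y) ∧
    ∀ x : A.domain, R (s • (x : H) - A x) = x

/-- The spectrum: all `s` for which `s - A` has no bounded inverse defined on all of `H`. -/
def spectrum (A : H →ₗ.[ℂ] H) : Set ℂ :=
  {s | ¬ ∃ R : H →L[ℂ] H, IsResolventAt A s R}

/-- The set of eigenvalues. -/
def pointSpectrum (A : H →ₗ.[ℂ] H) : Set ℂ :=
  {s | ∃ x : A.domain, (x : H) ≠ 0 ∧ A x = s • (x : H)}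

open Classical in
/-- The resolvent `(s - A)⁻¹` (and `0` for `s` in the spectrum). -/
def resolvent (A : H →ₗ.[ℂ] H) (s : ℂ) : H →L[ℂ] H :=
  if h : ∃ R : H →L[ℂ] H, IsResolventAt A s R then h.choose else 0

open Classical in
/-- The radius of a closed disc around `s` that contains no point of the spectrum except possibly
`s` (such a disc exists when the spectrum has no finite accumulation point). -/
def isolatingRadius (A : H →ₗ.[ℂ] H) (s : ℂ) : ℝ :=
  if h : ∃ r : ℝ, 0 < r ∧ Metric.closedBall s r ∩ spectrum A ⊆ {s} then h.choose else 1

/-- The Riesz projection `(2πi)⁻¹ ∮ (z - A)⁻¹ dz` of the isolated spectral point `s`. -/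
def rieszProjection (A : H →ₗ.[ℂ] H) (s : ℂ) : H →L[ℂ] H :=
  (2 * (Real.pi : ℂ) * Complex.I)⁻¹ • ∮ z in C(s, isolatingRadius A s), resolvent A z

/-- `Image(P_{s})`. -/
def rieszImage (A : H →ₗ.[ℂ] H) (s : ℂ) : Submodule ℂ H :=
  LinearMap.range (rieszProjection A s : H →ₗ[ℂ] H)

/-- `Ker((s - A)^k)`, where `(s - A)^k` has its natural domain. -/
def kerPow (A : H →ₗ.[ℂ] H) (s : ℂ) : ℕ → Submodule ℂ H
  | 0 => ⊥
  | k + 1 => ((kerPow A s k).comap (s • A.domain.subtype - A.toFun)).map A.domain.subtype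

/-- The Riesz index: the smallest positive `k` with `Ker((s - A)^k) = Image(P_{s})`
(`0` if there is none). -/
def rieszIndex (A : H →ₗ.[ℂ] H) (s : ℂ) : ℕ :=
  sInf {k : ℕ | 0 < k ∧ kerPow A s k = rieszImage A s}

/-- The algebraic multiplicity `dim Image(P_{s})`. -/
def mult (A : H →ₗ.[ℂ] H) (s : ℂ) : ℕ := Module.finrank ℂ (rieszImage A s)

/-- The class of operators under consideration. -/
structure IsAdmissible (A : H →ₗ.[ℂ] H) : Prop where
  closed : A.IsClosed
  spectrum_eq : spectrum A = pointSpectrum A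
  no_acc : ∀ z : ℂ, ¬ AccPt z (𝓟 (spectrum A))
  finite_dim : ∀ s ∈ pointSpectrum A, FiniteDimensional ℂ (rieszImage A s)
  riesz_index : ∀ s ∈ pointSpectrum A, rieszIndex A s = 1
  strip : ∀ s ∈ spectrum A, 0 < s.re ∧ s.re < 1
  left_iff_right : (∃ s ∈ spectrum A, s.re < 1 / 2) ↔ ∃ s ∈ spectrum A, 1 / 2 < s.re
  conj_mem : ∀ s ∈ spectrum A, starRingEnd ℂ s ∈ spectrum A ∧ mult A (starRingEnd ℂ s) = mult A s

/-- The Riemann Hypothesis for `A`. -/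
def RiemannHypothesisFor (A : H →ₗ.[ℂ] H) : Prop := ∀ s ∈ spectrum A, s.re = 1 / 2

/-- The closure of the critical strip `0 < Re s < 1`. -/
def closedStrip : Set ℂ := {s | 0 ≤ s.re ∧ s.re ≤ 1}

theorem closure_criticalStrip : closure {s : ℂ | 0 < s.re ∧ s.re < 1} = closedStrip := by
  have h := Complex.closure_preimage_re (Set.Ioo (0 : ℝ) 1)
  rw [closure_Ioo zero_ne_one] at h
  exact h

/-- The point `0` of the closed strip. -/
def pt0 : closedStrip := ⟨0, by simp [closedStrip]⟩

/-- The point `1` of the closed strip. -/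
def pt1 : closedStrip := ⟨1, by simp [closedStrip]⟩

/-- The real algebra of functions holomorphic on an open set containing the closed critical strip
and satisfying `φ(s̄) = conj (φ(s))` for `s ∈ σ(A) ∪ {0, 1}`. Two such functions are identified when
they agree on the closed strip (equivalently, by the identity theorem, near the closed strip),
so an element is recorded by its values there. -/
def holAlg (A : H →ₗ.[ℂ] H) : Subalgebra ℝ (closedStrip → ℂ) where
  carrier := {φ |
    (∃ (U : Set ℂ) (f : ℂ → ℂ), IsOpen U ∧ closedStrip ⊆ U ∧ DifferentiableOn ℂ f U ∧
      ∀ z : closedStrip, f z = φ z) ∧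
    ∀ z w : closedStrip, (z : ℂ) ∈ spectrum A ∪ {0, 1} → (w : ℂ) = starRingEnd ℂ (z : ℂ) →
      φ w = starRingEnd ℂ (φ z)}
  mul_mem' := by
    rintro φ ψ ⟨⟨U, f, hU, hSU, hf, hfφ⟩, hφ⟩ ⟨⟨W, g, hW, hSW, hg, hgψ⟩, hψ⟩
    refine ⟨⟨U ∩ W, f * g, hU.inter hW, Set.subset_inter hSU hSW,
      (hf.mono Set.inter_subset_left).mul (hg.mono Set.inter_subset_right), fun z => ?_⟩, ?_⟩
    · simp [hfφ, hgψ]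
    · intro z w hz hw
      simp [hφ z w hz hw, hψ z w hz hw]
  add_mem' := by
    rintro φ ψ ⟨⟨U, f, hU, hSU, hf, hfφ⟩, hφ⟩ ⟨⟨W, g, hW, hSW, hg, hgψ⟩, hψ⟩
    refine ⟨⟨U ∩ W, f + g, hU.inter hW, Set.subset_inter hSU hSW,
      (hf.mono Set.inter_subset_left).add (hg.mono Set.inter_subset_right), fun z => ?_⟩, ?_⟩
    · simp [hfφ, hgψ]
    · intro z w hz hw
      simp [hφ z w hz hw, hψ z w hz hw]
  algebraMap_mem' := by
    intro r
    refine ⟨⟨Set.univ, fun _ => (r : ℂ), isOpen_univ, Set.subset_univ _,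
      differentiableOn_const _, fun z => ?_⟩, ?_⟩
    · simp [Pi.algebraMap_apply]
    · intro z w _ _
      simp [Pi.algebraMap_apply]

/-- `φ(1)`, which is a real number because of the symmetry condition in `holAlg`. -/
def qTilde {A : H →ₗ.[ℂ] H} (φ : holAlg A) : ℝ := (φ.1 pt1).re

/-- `φ` is a cut-off function for the part `σ_Y(A) = {s ∈ σ(A) : |Im s| ≤ Y}` of the spectrum. -/
structure IsCutoff (A : H →ₗ.[ℂ] H) (Y : ℝ) (φ : holAlg A) : Prop where
  at_zero : φ.1 pt0 = 1
  q_pos : 0 < qTilde φ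
  q_ne_one : qTilde φ ≠ 1
  on_low : ∀ z : closedStrip, (z : ℂ) ∈ spectrum A → |(z : ℂ).im| ≤ Y →
    φ.1 z = (qTilde φ : ℂ) ^ (z : ℂ)
  on_high : ∀ z : closedStrip, (z : ℂ) ∈ spectrum A → Y < |(z : ℂ).im| → φ.1 z = 0

/-- `tr(φ(A)^n) = t`, the trace being that of the `n`-th power of `φ(A)` on the image of `φ(A)`:
the sum of `mult(s) φ(s)^n` over all `s ∈ σ(A)` with `φ(s) ≠ 0` converges and has the value `t`.
For `n ≥ 1` this is the sum over all of `σ(A)`; for `n = 0` it is the dimension of the image. -/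
def HasTracePow {A : H →ₗ.[ℂ] H} (φ : holAlg A) (n : ℕ) (t : ℂ) : Prop :=
  HasSum (fun z : {z : closedStrip // (z : ℂ) ∈ spectrum A ∧ φ.1 z ≠ 0} =>
    (mult A (z.1 : ℂ) : ℂ) * φ.1 z.1 ^ n) t

end Operators

/-- The form `⟨x, y⟩_V = β(x,v₀₁)β(y,v₁₀) + β(x,v₁₀)β(y,v₀₁) - β(x,y)`. -/
def pairing {V : Type*} [AddCommGroup V] [Module ℝ V] (β : LinearMap.BilinForm ℝ V)
    (v01 v10 x y : V) : ℝ :=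
  β x v01 * β y v10 + β x v10 * β y v01 - β x y

/-- The axioms of an abstract intersection theory for `A` with respect to the cut-off functions
`φ Y`, `Y > 0`. The domain `D` of `vδ` and `Φ` is a subalgebra which need not contain `1`; if it
does, then `Φ` is unital. -/
structure IsIntersectionTheory {H : Type*} [NormedAddCommGroup H] [InnerProductSpace ℂ H]
    (A : H →ₗ.[ℂ] H) (φ : ℝ → holAlg A)
    {V : Type*} [AddCommGroup V] [Module ℝ V] (β : LinearMap.BilinForm ℝ V) (v01 v10 ha : V)
    (D : NonUnitalSubalgebra ℝ (holAlg A)) (vδ : D → V) (Φ : D →ₙₐ[ℝ] Module.End ℝ V) : Prop where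
  v01_ne : v01 ≠ 0
  v10_ne : v10 ≠ 0
  ha_ne : ha ≠ 0
  map_one : ∀ h : (1 : holAlg A) ∈ D, Φ ⟨1, h⟩ = 1
  mem_dom : ∀ Y : ℝ, 0 < Y → φ Y ∈ D
  int1a : β v01 v01 = 0
  int1b : β v10 v10 = 0
  int1c : β v01 v10 = 1
  int1d : ∀ (Y : ℝ) (hY : 0 < Y) (n : ℕ),
    β ((Φ ⟨φ Y, mem_dom Y hY⟩ ^ n) (vδ ⟨φ Y, mem_dom Y hY⟩)) v01 = 1
  int1e : ∀ (Y : ℝ) (hY : 0 < Y),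
    (fun n : ℕ => β ((Φ ⟨φ Y, mem_dom Y hY⟩ ^ n) (vδ ⟨φ Y, mem_dom Y hY⟩)) v10)
      =O[atTop] fun n : ℕ => qTilde (φ Y) ^ n
  int1f : ∀ (Y : ℝ) (hY : 0 < Y),
    (fun n : ℕ => β ((Φ ⟨φ Y, mem_dom Y hY⟩ ^ n) (vδ ⟨φ Y, mem_dom Y hY⟩))
        ((Φ ⟨φ Y, mem_dom Y hY⟩ ^ n) (vδ ⟨φ Y, mem_dom Y hY⟩)))
      =O[atTop] fun n : ℕ => qTilde (φ Y) ^ n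
  int1g : ∀ x y : V, β x y = β y x
  int2 : ∀ x : V, β x ha = 0 → β x x ≤ 0
  int3 : ∀ (ψ : D) (n : ℕ),
    HasTracePow (ψ : holAlg A) n ((pairing β v01 v10 ((Φ ψ ^ n) (vδ ψ)) (vδ ψ) : ℝ) : ℂ)

end AbsInt

end

namespace AbsInt

/-! This is the pattern of Weil's proof for curves over finite fields. For (ii) ⇒ (i), the Hodge
index condition makes the pairing positive semidefinite (`pairing_self_nonneg`), so Cauchy-Schwarz
applied to `Φⁿ vδ` and `vδ`, together with the growth conditions, gives `tr(φ(A)ⁿ) = O(q^(n/2))`.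
This trace is a finite power sum with positive weights, so no cancellation can hide a large term:
every `|φ(s)| = q^(Re s)` is at most `q^(1/2)` (`norm_le_of_sum_mul_pow_isBigO`). Hence all `s` in
the window lie on one side of the critical line, and (OP5)(a) puts them on the line.

For (i) ⇒ (ii), a hyperbolic plane minus the form `∑ mult(s) Re(x_s conj y_s)` on functions on the
spectrum is a model in which `ψ` acts by multiplication with its values. The Riemann Hypothesis
enters only as `|φ(s)|² = q`, which bounds the self-intersections.

Cut-off functions exist because an entire function killing the high spectrum can be corrected by a
polynomial at the finitely many remaining points. -/

/-! ### Analytic tools: entire functions with prescribed zeros, and power sums -/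

/-- The product of the factors `1 - exp(±i(n_s + 1)(s - z))`, where `n_s` enumerates `S` and the
sign is that of `Im s`, works. The exponential has modulus at most `exp((n_s + 1)(|Im z| - |Im
s|))`. This is less than `1` on the strip `|Im z| ≤ Y`, so no factor vanishes there, and it is
eventually summable on every horizontal strip. -/
theorem exists_differentiable_zero_on {S : Set ℂ}
    (hS : ∀ T : ℝ, (S ∩ {s | |s.im| ≤ T}).Finite) {Y : ℝ} (hSY : ∀ s ∈ S, Y < |s.im|) :
    ∃ P : ℂ → ℂ, Differentiable ℂ P ∧ (∀ s ∈ S, P s = 0) ∧ ∀ z : ℂ, |z.im| ≤ Y → P z ≠ 0 := by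
  have hcount : S.Countable := by
    have : S = ⋃ n : ℕ, S ∩ {s | |s.im| ≤ n} := by
      ext s
      simp only [Set.mem_iUnion, Set.mem_inter_iff, Set.mem_ofPred_eq]
      exact ⟨fun h => (exists_nat_ge |s.im|).imp fun n hn => ⟨h, hn⟩, fun ⟨_, h⟩ => h.1⟩
    rw [this]
    exact Set.countable_iUnion fun n => (hS n).countable
  have := hcount.to_subtype
  obtain ⟨enc, henc⟩ := exists_injective_nat S
  have hsign : ∀ x : ℝ, ∃ e : ℝ, |e| = 1 ∧ e * x = |x| := fun x => by
    rcases le_total 0 x with h | h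
    · exact ⟨1, by simp, by simp [abs_of_nonneg h]⟩
    · exact ⟨-1, by simp, by simp [abs_of_nonpos h]⟩
  choose e he1 he2 using hsign
  set f : S → ℂ → ℂ := fun s z =>
    -Complex.exp ((((enc s + 1 : ℝ) * e s.1.im : ℝ) : ℂ) * Complex.I * (s.1 - z)) with hf
  have hnorm : ∀ s z, ‖f s z‖ ≤ Real.exp ((enc s + 1 : ℝ) * (|z.im| - |s.1.im|)) := by
    intro s z
    rw [hf, norm_neg, Complex.norm_exp, Real.exp_le_exp]
    have h1 : ((((enc s + 1 : ℝ) * e s.1.im : ℝ) : ℂ) * Complex.I * (s.1 - z)).re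
        = (enc s + 1 : ℝ) * (e s.1.im * z.im - e s.1.im * s.1.im) := by
      simp only [Complex.mul_re, Complex.mul_im, Complex.ofReal_re, Complex.ofReal_im,
        Complex.I_re, Complex.I_im, Complex.sub_re, Complex.sub_im]
      ring
    rw [h1, he2]
    have h2 : e s.1.im * z.im ≤ |z.im| := by
      calc e s.1.im * z.im ≤ |e s.1.im * z.im| := le_abs_self _
        _ = |z.im| := by rw [abs_mul, he1, one_mul]
    gcongr
  have hsum : Summable fun s : S => Real.exp (-(enc s : ℝ)) :=
    Real.summable_exp_neg_nat.comp_injective henc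
  have hev : ∀ T : ℝ, ∀ᶠ s in cofinite, ∀ z ∈ {z : ℂ | |z.im| < T},
      ‖f s z‖ ≤ Real.exp (-(enc s : ℝ)) := by
    intro T
    have hfin : {s : S | |s.1.im| ≤ T + 1}.Finite := by
      refine Set.Finite.of_finite_image ((hS (T + 1)).subset ?_) Subtype.val_injective.injOn
      rintro _ ⟨s, hs, rfl⟩
      exact ⟨s.2, hs⟩
    filter_upwards [hfin.compl_mem_cofinite] with s hs z hz
    -- Here `|Im z| - |Im s| < -1`, so the exponent is below `-(n_s + 1)`.
    simp only [Set.mem_compl_iff, Set.mem_ofPred_eq, not_le] at hs hz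
    refine (hnorm s z).trans (Real.exp_le_exp.2 ?_)
    have : (0 : ℝ) ≤ enc s := Nat.cast_nonneg _
    nlinarith
  have hcont : ∀ s, Differentiable ℂ (f s) := fun s => by
    simp only [hf]
    fun_prop
  refine ⟨fun z => ∏' s, (1 + f s z), fun z => ?_, fun s hs => ?_, fun z hz => ?_⟩
  · have hopen : IsOpen {w : ℂ | |w.im| < |z.im| + 1} :=
      isOpen_lt (by fun_prop) (by fun_prop)
    have := Summable.hasProdLocallyUniformlyOn_one_add hopen hsum (hev _)
      fun s => (hcont s).continuous.continuousOn
    refine (this.differentiableOn (.of_forall fun t => ?_) hopen).differentiableAt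
      (hopen.mem_nhds (by simp))
    simpa [Finset.prod_fn] using
      DifferentiableOn.finsetProd fun s _ => ((hcont s).const_add 1).differentiableOn
  · refine tprod_of_exists_eq_zero ⟨⟨s, hs⟩, ?_⟩
    simp [hf]
  · refine tprod_one_add_ne_zero_of_summable (fun s => ?_) ?_
    · intro h0
      have h1 : f s z = -1 := by linear_combination h0
      have h2 := hnorm s z
      rw [h1, norm_neg, norm_one, Real.one_le_exp_iff] at h2
      have h3 : (0 : ℝ) < enc s + 1 := by positivity
      have h4 := hSY s s.2
      nlinarith
    · refine hsum.of_norm_bounded_eventually ?_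
      filter_upwards [hev (Y + 1)] with s hs
      exact (norm_norm _).le.trans (hs z (lt_of_le_of_lt hz (lt_add_one Y)))

/-- A polynomial in the shift `n ↦ n + 1` preserves the bound `O(r^n)`. The Lagrange polynomial that
is `1` at `z i` and `0` at the other values isolates `M * z i ^ n`, where `M > 0` collects the
weights of all indices sharing the value `z i`. -/
theorem norm_le_of_sum_mul_pow_isBigO {ι : Type*} [Fintype ι] {m : ι → ℝ} (hm : ∀ i, 0 < m i)
    (z : ι → ℂ) {r : ℝ} (hr : 0 < r)
    (h : (fun n : ℕ => ∑ i, (m i : ℂ) * z i ^ n) =O[atTop] fun n : ℕ => r ^ n) (i : ι) :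
    ‖z i‖ ≤ r := by
  classical
  set p : Polynomial ℂ := Lagrange.basis (Finset.univ.image z) id (z i) with hp
  have hp1 : p.eval (z i) = 1 :=
    Lagrange.eval_basis_self (v := id) Function.injective_id.injOn
      (Finset.mem_image_of_mem z (Finset.mem_univ i))
  have hp0 : ∀ j, z j ≠ z i → p.eval (z j) = 0 := fun j hj =>
    Lagrange.eval_basis_of_ne (v := id) (Ne.symm hj)
      (Finset.mem_image_of_mem z (Finset.mem_univ j))
  set M : ℝ := ∑ j with z j = z i, m j with hM
  have hMpos : 0 < M := Finset.sum_pos (fun j _ => hm j) ⟨i, by simp⟩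
  have hshift : ∀ k : ℕ, (fun n : ℕ => p.coeff k * ∑ j, (m j : ℂ) * z j ^ (n + k))
      =O[atTop] fun n : ℕ => r ^ n := fun k => by
    refine IsBigO.const_mul_left ((h.comp_tendsto (tendsto_add_atTop_nat k)).trans ?_) _
    simp only [Function.comp_def, pow_add]
    exact (isBigO_refl _ _).mul (isBigO_const_const _ one_ne_zero _) |>.congr_right (by simp)
  have hcomb : (fun n : ℕ => (M : ℂ) * z i ^ n) =O[atTop] fun n : ℕ => r ^ n := by
    refine (IsBigO.sum (s := Finset.range (p.natDegree + 1)) fun k _ => hshift k).congr_left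
      fun n => ?_
    rw [Finset.sum_apply]
    calc ∑ k ∈ Finset.range (p.natDegree + 1), p.coeff k * ∑ j, (m j : ℂ) * z j ^ (n + k)
        = ∑ j, (m j : ℂ) * z j ^ n * p.eval (z j) := by
          simp_rw [Polynomial.eval_eq_sum_range, Finset.mul_sum]
          rw [Finset.sum_comm]
          refine Finset.sum_congr rfl fun j _ => Finset.sum_congr rfl fun k _ => ?_
          ring
      _ = ∑ j with z j = z i, (m j : ℂ) * z i ^ n := by
          rw [Finset.sum_filter]
          refine Finset.sum_congr rfl fun j _ => ?_
          split_ifs with hj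
          · rw [hj, hp1, mul_one]
          · rw [hp0 j hj, mul_zero]
      _ = M * z i ^ n := by rw [← Finset.sum_mul, hM, Complex.ofReal_sum]
  by_contra! hlt
  have h1 : (fun n : ℕ => z i ^ n) =O[atTop] fun n : ℕ => r ^ n :=
    (isBigO_const_mul_left_iff (by exact_mod_cast hMpos.ne')).1 hcomb
  have h2 : (fun n : ℕ => r ^ n) =o[atTop] fun n : ℕ => z i ^ n := by
    refine IsLittleO.of_norm_right ?_
    simpa using isLittleO_pow_pow_of_lt_left hr.le hlt
  have h3 := h1.trans_isLittleO h2
  have hz : z i ≠ 0 := norm_pos_iff.1 (hr.trans hlt)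
  exact isLittleO_irrefl (Frequently.of_forall fun n => pow_ne_zero n hz) h3

/-! ### The spectrum of an admissible operator and the existence of cut-off functions -/

section Operators

variable {H : Type*} [NormedAddCommGroup H] [InnerProductSpace ℂ H] {A : H →ₗ.[ℂ] H}

theorem IsAdmissible.mult_pos (hA : IsAdmissible A) {s : ℂ} (hs : s ∈ spectrum A) :
    0 < mult A s := by
  rw [hA.spectrum_eq] at hs
  have := hA.finite_dim s hs
  have hmem : 1 ∈ {k : ℕ | 0 < k ∧ kerPow A s k = rieszImage A s} := by
    have h1 := hA.riesz_index s hs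
    rw [← h1]
    -- The infimum of the empty set is `0`, so index `1` means that the minimum is attained; thus
    -- the Riesz image is the eigenspace.
    refine Nat.sInf_mem (Set.nonempty_iff_ne_empty.2 fun h0 => ?_)
    rw [rieszIndex, h0, Nat.sInf_empty] at h1
    exact zero_ne_one h1
  obtain ⟨x, hx0, hx⟩ := hs
  have hxmem : (x : H) ∈ rieszImage A s := by
    rw [← hmem.2]
    refine ⟨x, ?_, rfl⟩
    have : s • (x : H) - A x = 0 := by rw [hx, sub_self]
    simpa [kerPow] using this
  have : Nontrivial (rieszImage A s) := ⟨⟨x, hxmem⟩, 0, fun h => hx0 (congrArg Subtype.val h)⟩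
  exact Module.finrank_pos

theorem IsAdmissible.mem_closedStrip (hA : IsAdmissible A) {s : ℂ} (hs : s ∈ spectrum A) :
    s ∈ closedStrip :=
  ⟨(hA.strip s hs).1.le, (hA.strip s hs).2.le⟩

theorem IsAdmissible.finite_spectrum_inter (hA : IsAdmissible A) (T : ℝ) :
    (spectrum A ∩ {s | |s.im| ≤ T}).Finite := by
  by_contra hinf
  obtain ⟨z, -, hz⟩ := Set.Infinite.exists_accPt_of_subset_isCompact hinf
    (isCompact_closedBall (0 : ℂ) (1 + T)) fun s hs => by
      have h := hA.strip s hs.1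
      rw [mem_closedBall_zero_iff]
      refine (Complex.norm_le_abs_re_add_abs_im s).trans (add_le_add ?_ hs.2)
      rw [abs_of_pos h.1]
      exact h.2.le
  exact hA.no_acc z (hz.mono (principal_mono.2 Set.inter_subset_left))

/-- The function is `P * p` with `q = 2`: `P` kills the high spectrum and has no zero on the window,
so a polynomial `p` can interpolate `2^z / P z` at `0`, `1` and the low spectrum. Conjugation
symmetry is demanded only on the spectrum and at `0`, `1`, where the values are `2^z` or `0`; `P`
and `p` need not be symmetric. -/
theorem IsAdmissible.exists_isCutoff (hA : IsAdmissible A) {Y : ℝ} (hY : 0 < Y) :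
    ∃ φ : holAlg A, IsCutoff A Y φ := by
  classical
  obtain ⟨P, hPd, hP0, hP1⟩ := exists_differentiable_zero_on
    (S := spectrum A ∩ {s | Y < |s.im|})
    (fun T => (hA.finite_spectrum_inter T).subset fun s hs => ⟨hs.1.1, hs.2⟩) (fun s hs => hs.2)
  set F : Finset ℂ := insert 0 (insert 1 (hA.finite_spectrum_inter Y).toFinset) with hF
  set p : Polynomial ℂ := Lagrange.interpolate F id fun z => (2 : ℂ) ^ z / P z with hp
  have hFim : ∀ z ∈ F, |z.im| ≤ Y := by
    intro z hz
    simp only [hF, Finset.mem_insert, Set.Finite.mem_toFinset] at hz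
    rcases hz with rfl | rfl | hz
    · simpa using hY.le
    · simpa using hY.le
    · exact hz.2
  have hlow : ∀ z ∈ F, P z * p.eval z = (2 : ℂ) ^ z := fun z hz => by
    have := Lagrange.eval_interpolate_at_node (fun z => (2 : ℂ) ^ z / P z)
      (v := id) Function.injective_id.injOn hz
    rw [id] at this
    rw [hp, this, mul_div_cancel₀ _ (hP1 z (hFim z hz))]
  have hhigh : ∀ z ∈ spectrum A, Y < |z.im| → P z * p.eval z = 0 := fun z hz h => by
    rw [hP0 z ⟨hz, h⟩, zero_mul]
  have h0 : (0 : ℂ) ∈ F := by simp [hF]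
  have h1 : (1 : ℂ) ∈ F := by simp [hF]
  have hspec : ∀ z ∈ spectrum A, |z.im| ≤ Y → z ∈ F := fun z hz h => by
    simp only [hF, Finset.mem_insert, Set.Finite.mem_toFinset]
    exact Or.inr (Or.inr ⟨hz, h⟩)
  have hconjpow : ∀ z : ℂ, (2 : ℂ) ^ starRingEnd ℂ z = starRingEnd ℂ ((2 : ℂ) ^ z) := fun z => by
    rw [Complex.cpow_conj _ _ (by simp [Real.pi_ne_zero.symm]), Complex.conj_ofNat]
  have hmem : (fun z : closedStrip => P z * p.eval (z : ℂ)) ∈ holAlg A := by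
    refine ⟨⟨Set.univ, fun z => P z * p.eval z, isOpen_univ,
      Set.subset_univ _, (hPd.mul p.differentiable).differentiableOn, fun _ => rfl⟩, ?_⟩
    rintro ⟨z, hz⟩ ⟨w, hw⟩ hzs hzw
    simp only at hzs hzw ⊢
    subst hzw
    rcases hzs with hzs | rfl | rfl
    · rcases le_or_gt |z.im| Y with h | h
      · rw [hlow _ (hspec _ hzs h), hlow _ (hspec _ (hA.conj_mem z hzs).1 (by simpa using h)),
          hconjpow]
      · rw [hhigh _ hzs h, hhigh _ (hA.conj_mem z hzs).1 (by simpa using h), map_zero]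
    · rw [map_zero, hlow _ h0]
      simp
    · rw [map_one, hlow _ h1, Complex.cpow_one, Complex.conj_ofNat]
  have hq : qTilde (⟨_, hmem⟩ : holAlg A) = 2 := by
    simp [qTilde, pt1, hlow 1 h1]
  refine ⟨⟨_, hmem⟩, ?_, ?_, ?_, fun z hz h => ?_, fun z hz h => hhigh _ hz h⟩
  · simpa [pt0] using hlow 0 h0
  · rw [hq]
    norm_num
  · rw [hq]
    norm_num
  · rw [hq]
    simpa using hlow _ (hspec _ hz h)

end Operators

/-! ### Hodge index and Cauchy-Schwarz -/

section Pairing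

variable {V : Type*} [AddCommGroup V] [Module ℝ V] (β : LinearMap.BilinForm ℝ V) (v01 v10 : V)

/-- `pairing` as a bilinear form. -/
def pairingForm : LinearMap.BilinForm ℝ V :=
  (β.flip v01).smulRight (β.flip v10) + (β.flip v10).smulRight (β.flip v01) - β

theorem pairingForm_apply (x y : V) : pairingForm β v01 v10 x y = pairing β v01 v10 x y := by
  simp [pairingForm, pairing]

/-- The pairing of `x` with itself is `-β y y`, where `y` is the component of `x` orthogonal to the
hyperbolic plane. If `β y y > 0`, then `y` and `p = v01 + v10`, with `β p p = 2`, span a positive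
definite plane, which must meet the hyperplane orthogonal to `ha`. -/
theorem pairing_self_nonneg {β : LinearMap.BilinForm ℝ V} {v01 v10 ha : V}
    (h1 : β v01 v01 = 0) (h2 : β v10 v10 = 0) (h3 : β v01 v10 = 1) (hsymm : ∀ x y, β x y = β y x)
    (hodge : ∀ x, β x ha = 0 → β x x ≤ 0) (x : V) : 0 ≤ pairing β v01 v10 x x := by
  set y : V := x - β x v10 • v01 - β x v01 • v10 with hy
  set p : V := v01 + v10 with hp
  have h3' : β v10 v01 = 1 := by rw [hsymm, h3]
  have hyy : β y y = -pairing β v01 v10 x x := by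
    simp only [hy, pairing, map_sub, map_smul, LinearMap.sub_apply, LinearMap.smul_apply,
      smul_eq_mul, h1, h2, h3, h3', hsymm v01 x, hsymm v10 x]
    ring
  have hyp : β y p = 0 := by
    simp only [hy, hp, map_sub, map_add, map_smul, LinearMap.sub_apply, LinearMap.smul_apply,
      smul_eq_mul, h1, h2, h3, h3']
    ring
  have hpp : β p p = 2 := by
    simp only [hp, map_add, LinearMap.add_apply, h1, h2, h3, h3']
    norm_num
  -- The combination of `y` and `p` orthogonal to `ha`. It may be zero, but only if `β y ha = 0`,
  -- and then the Hodge condition applies to `y` itself.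
  have hz := hodge (β p ha • y - β y ha • p) (by
    simp only [map_sub, map_smul, LinearMap.sub_apply, LinearMap.smul_apply, smul_eq_mul]
    ring)
  have hzz : β (β p ha • y - β y ha • p) (β p ha • y - β y ha • p)
      = β p ha ^ 2 * β y y + 2 * β y ha ^ 2 := by
    simp only [map_sub, map_smul, LinearMap.sub_apply, LinearMap.smul_apply, smul_eq_mul,
      hyp, hsymm p y, hpp]
    ring
  rw [hzz] at hz
  by_contra! hneg
  have hpos : 0 < β y y := by linarith
  have hy0 : β y ha = 0 := by
    have := mul_nonneg (sq_nonneg (β p ha)) hpos.le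
    exact pow_eq_zero_iff two_ne_zero |>.1 (by nlinarith [sq_nonneg (β y ha)])
  exact absurd (hodge y hy0) (not_le.2 hpos)

theorem pairing_sq_le {β : LinearMap.BilinForm ℝ V} {v01 v10 ha : V}
    (h1 : β v01 v01 = 0) (h2 : β v10 v10 = 0) (h3 : β v01 v10 = 1) (hsymm : ∀ x y, β x y = β y x)
    (hodge : ∀ x, β x ha = 0 → β x x ≤ 0) (x y : V) :
    pairing β v01 v10 x y ^ 2 ≤ pairing β v01 v10 x x * pairing β v01 v10 y y := by
  simp only [← pairingForm_apply]
  refine LinearMap.BilinForm.apply_sq_le_of_symm _ (fun x => ?_) ⟨fun x y => ?_⟩ x y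
  · rw [pairingForm_apply]
    exact pairing_self_nonneg h1 h2 h3 hsymm hodge x
  · simp only [pairingForm_apply, pairing, hsymm y x, RingHom.id_apply]
    ring

end Pairing

/-! ### An intersection theory implies the Riemann Hypothesis -/

section Operators

variable {H : Type*} [NormedAddCommGroup H] [InnerProductSpace ℂ H] {A : H →ₗ.[ℂ] H}

theorem IsCutoff.low_of_ne_zero {Y : ℝ} {φ : holAlg A} (hφ : IsCutoff A Y φ) {z : closedStrip}
    (hz : (z : ℂ) ∈ spectrum A) (h0 : φ.1 z ≠ 0) : |(z : ℂ).im| ≤ Y :=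
  le_of_not_gt fun h => h0 (hφ.on_high z hz h)

theorem IsCutoff.norm_eq {Y : ℝ} {φ : holAlg A} (hφ : IsCutoff A Y φ) {z : closedStrip}
    (hz : (z : ℂ) ∈ spectrum A) (h : |(z : ℂ).im| ≤ Y) :
    ‖φ.1 z‖ = qTilde φ ^ (z : ℂ).re := by
  rw [hφ.on_low z hz h, Complex.norm_cpow_eq_rpow_re_of_pos hφ.q_pos]

theorem IsAdmissible.finite_support_isCutoff (hA : IsAdmissible A) {Y : ℝ} {φ : holAlg A}
    (hφ : IsCutoff A Y φ) : {z : closedStrip | (z : ℂ) ∈ spectrum A ∧ φ.1 z ≠ 0}.Finite := by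
  refine Set.Finite.of_finite_image ((hA.finite_spectrum_inter Y).subset ?_)
    Subtype.val_injective.injOn
  rintro _ ⟨z, hz, rfl⟩
  exact ⟨hz.1, hφ.low_of_ne_zero hz.1 hz.2⟩

theorem IsIntersectionTheory.trace_isBigO {φ : ℝ → holAlg A}
    {V : Type*} [AddCommGroup V] [Module ℝ V] {β : LinearMap.BilinForm ℝ V} {v01 v10 ha : V}
    {D : NonUnitalSubalgebra ℝ (holAlg A)} {vδ : D → V} {Φ : D →ₙₐ[ℝ] Module.End ℝ V}
    (h : IsIntersectionTheory A φ β v01 v10 ha D vδ Φ) {Y : ℝ} (hY : 0 < Y)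
    (hq : 0 < qTilde (φ Y)) {t : ℕ → ℂ} (ht : ∀ n, HasTracePow (φ Y) n (t n)) :
    t =O[atTop] fun n : ℕ => √(qTilde (φ Y)) ^ n := by
  set ψ : D := ⟨φ Y, h.mem_dom Y hY⟩ with hψ
  set x : ℕ → V := fun n => (Φ ψ ^ n) (vδ ψ) with hx
  -- Since `β (x n) v01 = 1`, the pairing is `2 β (x n) v10 - β (x n) (x n)`.
  have hself : (fun n => pairing β v01 v10 (x n) (x n)) =O[atTop] fun n : ℕ => qTilde (φ Y) ^ n := by
    have h1 : ∀ n, β (x n) v01 = 1 := h.int1d Y hY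
    refine (((h.int1e Y hY).const_mul_left 2).sub (h.int1f Y hY)).congr_left fun n => ?_
    change 2 * β (x n) v10 - β (x n) (x n) = _
    rw [pairing, h1]
    ring
  have hsq : (fun n => pairing β v01 v10 (x n) (vδ ψ) ^ 2) =O[atTop]
      fun n : ℕ => qTilde (φ Y) ^ n := by
    refine IsBigO.trans (IsBigO.of_norm_le fun n => ?_)
      (hself.const_mul_left (pairing β v01 v10 (vδ ψ) (vδ ψ)))
    rw [Real.norm_of_nonneg (sq_nonneg _), mul_comm]
    exact pairing_sq_le h.int1a h.int1b h.int1c h.int1g h.int2 _ _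
  have hsq' : (fun n => pairing β v01 v10 (x n) (vδ ψ) ^ 2) =O[atTop]
      fun n : ℕ => (√(qTilde (φ Y)) ^ n) ^ 2 := by
    refine hsq.congr_right fun n => ?_
    rw [← pow_mul, mul_comm, pow_mul, Real.sq_sqrt hq.le]
  have hlin : (fun n => pairing β v01 v10 (x n) (vδ ψ)) =O[atTop]
      fun n : ℕ => √(qTilde (φ Y)) ^ n := IsBigO.of_pow two_ne_zero hsq'
  refine (Complex.isBigO_ofReal_left.2 hlin).congr_left fun n => ?_
  exact (h.int3 ψ n).unique (ht n)

theorem IsIntersectionTheory.riemannHypothesisFor (hA : IsAdmissible A) {φ : ℝ → holAlg A}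
    (hφ : ∀ Y, 0 < Y → IsCutoff A Y (φ Y))
    {V : Type*} [AddCommGroup V] [Module ℝ V] {β : LinearMap.BilinForm ℝ V} {v01 v10 ha : V}
    {D : NonUnitalSubalgebra ℝ (holAlg A)} {vδ : D → V} {Φ : D →ₙₐ[ℝ] Module.End ℝ V}
    (h : IsIntersectionTheory A φ β v01 v10 ha D vδ Φ) : RiemannHypothesisFor A := by
  have hbound : ∀ Y, 0 < Y → ∀ s ∈ spectrum A, |s.im| ≤ Y →
      qTilde (φ Y) ^ s.re ≤ qTilde (φ Y) ^ (1 / 2 : ℝ) := by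
    intro Y hY s hs hsY
    have hc := hφ Y hY
    have : Finite {z : closedStrip // (z : ℂ) ∈ spectrum A ∧ (φ Y).1 z ≠ 0} :=
      (hA.finite_support_isCutoff hc).to_subtype
    have := Fintype.ofFinite {z : closedStrip // (z : ℂ) ∈ spectrum A ∧ (φ Y).1 z ≠ 0}
    have htr := h.trace_isBigO hY hc.q_pos fun n => hasSum_fintype _
    have hs0 : (φ Y).1 ⟨s, hA.mem_closedStrip hs⟩ ≠ 0 := by
      rw [hc.on_low _ hs hsY]
      exact Complex.cpow_ne_zero_iff_of_exponent_ne_zero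
        (fun h0 => (hA.strip s hs).1.ne' (by rw [show s = 0 from h0, Complex.zero_re])) |>.2
        (by exact_mod_cast hc.q_pos.ne')
    have := norm_le_of_sum_mul_pow_isBigO
      (m := fun z : {z : closedStrip // (z : ℂ) ∈ spectrum A ∧ (φ Y).1 z ≠ 0} =>
        (mult A (z.1 : ℂ) : ℝ))
      (fun z => by exact_mod_cast hA.mult_pos z.2.1) (fun z => (φ Y).1 z.1)
      (Real.sqrt_pos.2 hc.q_pos) (by simpa using htr) ⟨⟨s, hA.mem_closedStrip hs⟩, hs, hs0⟩
    rwa [hc.norm_eq (z := ⟨s, hA.mem_closedStrip hs⟩) hs hsY, Real.sqrt_eq_rpow] at this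
  have hsides : ∀ s ∈ spectrum A, ∀ s' ∈ spectrum A, s.re < 1 / 2 → 1 / 2 < s'.re → False := by
    intro s hs s' hs' h1 h2
    -- One window holds both points, because it is not known whether `q < 1` or `q > 1`: in the
    -- first case `s` violates the bound, in the second `s'`.
    set Y := max 1 (max |s.im| |s'.im|) with hYdef
    have hY : 0 < Y := lt_max_of_lt_left one_pos
    have hc := hφ Y hY
    rcases lt_or_gt_of_ne hc.q_ne_one with hq | hq
    · exact absurd (hbound Y hY s hs (le_max_of_le_right (le_max_left _ _)))
        (not_le.2 (Real.rpow_lt_rpow_of_exponent_gt hc.q_pos hq h1))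
    · exact absurd (hbound Y hY s' hs' (le_max_of_le_right (le_max_right _ _)))
        (not_le.2 (Real.rpow_lt_rpow_of_exponent_lt hq h2))
  intro s hs
  rcases lt_trichotomy s.re (1 / 2) with hlt | heq | hgt
  · obtain ⟨s', hs', h'⟩ := hA.left_iff_right.1 ⟨s, hs, hlt⟩
    exact (hsides s hs s' hs' hlt h').elim
  · exact heq
  · obtain ⟨s', hs', h'⟩ := hA.left_iff_right.2 ⟨s, hs, hgt⟩
    exact (hsides s' hs' s hs h' hgt).elim

end Operators

noncomputable section

/-! ### The positive form on functions on the spectrum -/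

section WeightedForm

variable {ι : Type*}

theorem hasSum_finsupp_mul_re (m : ι → ℝ) (x y : ι →₀ ℂ) :
    HasSum (fun i => m i * (x i * starRingEnd ℂ (y i)).re)
      (x.sum fun i a => m i * (a * starRingEnd ℂ (y i)).re) :=
  hasSum_sum_of_ne_finset_zero fun i hi => by simp [Finsupp.notMem_support_iff.1 hi]

/-- The real bilinear form `∑ i, m i * Re (x i * conj (y i))` on finitely supported functions. -/
def weightedForm (m : ι → ℝ) : LinearMap.BilinForm ℝ (ι →₀ ℂ) :=
  LinearMap.mk₂ ℝ (fun x y => x.sum fun i a => m i * (a * starRingEnd ℂ (y i)).re)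
    (fun x x' y => (hasSum_finsupp_mul_re m (x + x') y).unique
      (((hasSum_finsupp_mul_re m x y).add (hasSum_finsupp_mul_re m x' y)).congr_fun fun i => by
        simp [add_mul, mul_add]))
    (fun c x y => (hasSum_finsupp_mul_re m (c • x) y).unique
      (((hasSum_finsupp_mul_re m x y).mul_left c).congr_fun fun i => by
        simp; ring))
    (fun x y y' => (hasSum_finsupp_mul_re m x (y + y')).unique
      (((hasSum_finsupp_mul_re m x y).add (hasSum_finsupp_mul_re m x y')).congr_fun fun i => by
        simp; ring))
    (fun c x y => (hasSum_finsupp_mul_re m x (c • y)).unique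
      (((hasSum_finsupp_mul_re m x y).mul_left c).congr_fun fun i => by
        simp; ring))

theorem hasSum_weightedForm (m : ι → ℝ) (x y : ι →₀ ℂ) :
    HasSum (fun i => m i * (x i * starRingEnd ℂ (y i)).re) (weightedForm m x y) :=
  hasSum_finsupp_mul_re m x y

theorem weightedForm_comm (m : ι → ℝ) (x y : ι →₀ ℂ) :
    weightedForm m x y = weightedForm m y x := by
  refine (hasSum_weightedForm m x y).unique ((hasSum_weightedForm m y x).congr_fun fun i => ?_)
  simp only [Complex.mul_re, Complex.conj_re, Complex.conj_im]
  ring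

theorem weightedForm_self_nonneg {m : ι → ℝ} (hm : ∀ i, 0 ≤ m i) (x : ι →₀ ℂ) :
    0 ≤ weightedForm m x x := by
  refine (hasSum_weightedForm m x x).nonneg fun i => mul_nonneg (hm i) ?_
  rw [Complex.mul_conj, Complex.ofReal_re]
  exact Complex.normSq_nonneg _

end WeightedForm

/-! ### Adding a hyperbolic plane -/

section HyperbolicSum

variable {W : Type*} [AddCommGroup W] [Module ℝ W]

/-- The orthogonal sum of a hyperbolic plane and the negative of the form `B`. -/
def hyperbolicSum (B : LinearMap.BilinForm ℝ W) : LinearMap.BilinForm ℝ (ℝ × ℝ × W) :=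
  LinearMap.mk₂ ℝ (fun x y => x.1 * y.2.1 + x.2.1 * y.1 - B x.2.2 y.2.2)
    (fun x x' y => by simp; ring) (fun c x y => by simp; ring)
    (fun x y y' => by simp; ring) (fun c x y => by simp; ring)

theorem hyperbolicSum_apply (B : LinearMap.BilinForm ℝ W) (x y : ℝ × ℝ × W) :
    hyperbolicSum B x y = x.1 * y.2.1 + x.2.1 * y.1 - B x.2.2 y.2.2 := rfl

/-- The pairing discards the hyperbolic plane and reverses the sign on its complement, so it
recovers `B`. -/
theorem pairing_hyperbolicSum (B : LinearMap.BilinForm ℝ W) (x y : ℝ × ℝ × W) :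
    pairing (hyperbolicSum B) (1, 0, 0) (0, 1, 0) x y = B x.2.2 y.2.2 := by
  simp [pairing, hyperbolicSum_apply]
  ring

theorem hyperbolicSum_self_nonpos {B : LinearMap.BilinForm ℝ W} (hB : ∀ x, 0 ≤ B x x)
    (x : ℝ × ℝ × W) (hx : hyperbolicSum B x (1, 1, 0) = 0) : hyperbolicSum B x x ≤ 0 := by
  simp only [hyperbolicSum_apply, mul_one, map_zero, sub_zero] at hx ⊢
  have h1 : x.2.1 = -x.1 := by linarith
  have h2 := hB x.2.2
  rw [h1]
  nlinarith [sq_nonneg x.1]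

end HyperbolicSum

/-! ### The Riemann Hypothesis yields an intersection theory -/

section Operators

variable {H : Type*} [NormedAddCommGroup H] [InnerProductSpace ℂ H] {A : H →ₗ.[ℂ] H}

theorem holAlg_im_pt0 (ψ : holAlg A) : (ψ.1 pt0).im = 0 :=
  Complex.conj_eq_iff_im.1 (ψ.2.2 pt0 pt0 (by simp [pt0]) (by simp [pt0])).symm

theorem holAlg_im_pt1 (ψ : holAlg A) : (ψ.1 pt1).im = 0 :=
  Complex.conj_eq_iff_im.1 (ψ.2.2 pt1 pt1 (by simp [pt1]) (by simp [pt1])).symm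

variable (A) in
/-- The subalgebra of the functions vanishing at all but finitely many spectral points. -/
def finiteSupportAlg : NonUnitalSubalgebra ℝ (holAlg A) where
  carrier := {ψ | {z : closedStrip | (z : ℂ) ∈ spectrum A ∧ ψ.1 z ≠ 0}.Finite}
  zero_mem' := by simp
  add_mem' := by
    intro ψ χ hψ hχ
    refine (hψ.union hχ).subset fun z hz => ?_
    by_contra hcon
    simp only [Set.mem_union, Set.mem_ofPred_eq, not_or, not_and, not_not] at hcon
    exact hz.2 (by simp [hcon.1 hz.1, hcon.2 hz.1])
  mul_mem' := by
    intro ψ χ hψ _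
    exact hψ.subset fun z hz => ⟨hz.1, fun h0 => hz.2 (by simp [h0])⟩
  smul_mem' := by
    intro c ψ hψ
    exact hψ.subset fun z hz => ⟨hz.1, fun h0 => hz.2 (by simp [h0])⟩

variable (A) in
/-- The spectrum, as an index type in a prescribed universe. -/
abbrev SpecIndex : Type w := ULift.{w} {z : closedStrip // (z : ℂ) ∈ spectrum A}

variable (A) in
/-- The space of the model: a hyperbolic plane plus the finitely supported functions on the
spectrum. -/
abbrev ModelSpace : Type w := ℝ × ℝ × (SpecIndex.{w} A →₀ ℂ)

/-- The action of `ψ` on the model space through its values at `1`, `0` and the spectrum. -/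
def modelHom : holAlg A →ₐ[ℝ] Module.End ℝ (ModelSpace.{w} A) :=
  AlgHom.ofLinearMap
    { toFun := fun ψ =>
        { toFun := fun x => ((ψ.1 pt1).re * x.1, (ψ.1 pt0).re * x.2.1,
            (fun i : SpecIndex.{w} A => ψ.1 i.down.1) • x.2.2)
          map_add' := fun x y => by
            refine Prod.ext ?_ (Prod.ext ?_ (Finsupp.ext fun i => ?_))
            · simp; ring
            · simp; ring
            · simp; ring
          map_smul' := fun c x => by
            refine Prod.ext ?_ (Prod.ext ?_ (Finsupp.ext fun i => ?_))
            · simp; ring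
            · simp; ring
            · simp; ring }
      map_add' := fun ψ χ => by
        refine LinearMap.ext fun x => Prod.ext ?_ (Prod.ext ?_ (Finsupp.ext fun i => ?_))
        · simp; ring
        · simp; ring
        · simp; ring
      map_smul' := fun c ψ => by
        refine LinearMap.ext fun x => Prod.ext ?_ (Prod.ext ?_ (Finsupp.ext fun i => ?_))
        · simp; ring
        · simp; ring
        · simp; ring }
    (by
      refine LinearMap.ext fun x => Prod.ext ?_ (Prod.ext ?_ (Finsupp.ext fun i => ?_))
      · simp
      · simp
      · simp)
    (fun ψ χ => by
      refine LinearMap.ext fun x => Prod.ext ?_ (Prod.ext ?_ (Finsupp.ext fun i => ?_))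
      -- Taking real parts is multiplicative here because `ψ` is real at `0` and `1`.
      · simp [holAlg_im_pt1, mul_assoc]
      · simp [holAlg_im_pt0, mul_assoc]
      · simp [mul_assoc])

theorem modelHom_apply (ψ : holAlg A) (x : ModelSpace.{w} A) :
    modelHom ψ x = ((ψ.1 pt1).re * x.1, (ψ.1 pt0).re * x.2.1,
      (fun i : SpecIndex.{w} A => ψ.1 i.down.1) • x.2.2) := rfl

open Classical in
/-- The indicator function of the support of `ψ` on the spectrum. -/
def supportIndicator (ψ : finiteSupportAlg A) : SpecIndex.{w} A →₀ ℂ :=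
  Finsupp.ofSupportFinite (fun i => if ψ.1.1 i.down.1 = 0 then 0 else 1) <| by
    have hinj : Function.Injective fun i : SpecIndex.{w} A => i.down.1 :=
      Subtype.val_injective.comp ULift.down_injective
    refine Set.Finite.of_finite_image (f := fun i : SpecIndex.{w} A => i.down.1)
      (Set.Finite.subset ψ.2 ?_) hinj.injOn
    rintro _ ⟨i, hi, rfl⟩
    exact ⟨i.down.2, fun h0 => hi (by simp [h0])⟩

open Classical in
theorem supportIndicator_apply (ψ : finiteSupportAlg A) (i : SpecIndex.{w} A) :
    supportIndicator ψ i = if ψ.1.1 i.down.1 = 0 then 0 else 1 := rfl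

theorem modelHom_pow_apply (ψ : holAlg A) (n : ℕ) (w : SpecIndex.{w} A →₀ ℂ) :
    (modelHom ψ ^ n) (1, 1, w) = ((ψ.1 pt1).re ^ n, (ψ.1 pt0).re ^ n,
      (fun i : SpecIndex.{w} A => ψ.1 i.down.1 ^ n) • w) := by
  induction n with
  | zero =>
    refine Prod.ext ?_ (Prod.ext ?_ (Finsupp.ext fun i => ?_)) <;> simp
  | succ n ih =>
    rw [pow_succ', Module.End.mul_apply, ih, modelHom_apply]
    refine Prod.ext ?_ (Prod.ext ?_ (Finsupp.ext fun i => ?_))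
    · simp [pow_succ']
    · simp [pow_succ']
    · simp [pow_succ', mul_assoc]

/-- The multiplicity as a weight on the spectrum. -/
def specWeight (i : SpecIndex.{w} A) : ℝ := mult A (i.down.1 : ℂ)

theorem IsAdmissible.hasTracePow_weightedForm (hA : IsAdmissible A) (ψ : finiteSupportAlg A)
    (n : ℕ) :
    HasTracePow (ψ : holAlg A) n ((weightedForm (specWeight (A := A))
      ((fun i : SpecIndex.{w} A => ψ.1.1 i.down.1 ^ n) • supportIndicator ψ)
      (supportIndicator ψ) : ℝ) : ℂ) := by
  have : Finite {z : closedStrip // (z : ℂ) ∈ spectrum A ∧ ψ.1.1 z ≠ 0} := ψ.2.to_subtype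
  have := Fintype.ofFinite {z : closedStrip // (z : ℂ) ∈ spectrum A ∧ ψ.1.1 z ≠ 0}
  set T : ℂ := ∑ z : {z : closedStrip // (z : ℂ) ∈ spectrum A ∧ ψ.1.1 z ≠ 0},
    (mult A (z.1 : ℂ) : ℂ) * ψ.1.1 z.1 ^ n with hT
  have hsum : HasTracePow (ψ : holAlg A) n T := hasSum_fintype _
  have hconj : ∀ z w : closedStrip, (z : ℂ) ∈ spectrum A → (w : ℂ) = starRingEnd ℂ (z : ℂ) →
      ψ.1.1 w = starRingEnd ℂ (ψ.1.1 z) := fun z w hz hw => ψ.1.2.2 z w (Or.inl hz) hw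
  let σ : {z : closedStrip // (z : ℂ) ∈ spectrum A ∧ ψ.1.1 z ≠ 0} →
      {z : closedStrip // (z : ℂ) ∈ spectrum A ∧ ψ.1.1 z ≠ 0} := fun z =>
    ⟨⟨starRingEnd ℂ (z.1 : ℂ), hA.mem_closedStrip (hA.conj_mem _ z.2.1).1⟩,
      (hA.conj_mem _ z.2.1).1, by
        rw [hconj z.1 _ z.2.1 rfl]
        exact (map_ne_zero _).2 z.2.2⟩
  have hσ : Function.Involutive σ := fun z => Subtype.ext (Subtype.ext (Complex.conj_conj _))
  -- Conjugation permutes the support and preserves multiplicities, so the trace is real and equals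
  -- the weighted form, which only sees real parts.
  have hreal : starRingEnd ℂ T = T := by
    rw [hT, map_sum, ← Equiv.sum_comp hσ.toPerm]
    refine Finset.sum_congr rfl fun z _ => ?_
    have h1 : ψ.1.1 (σ z).1 = starRingEnd ℂ (ψ.1.1 z.1) := hconj z.1 _ z.2.1 rfl
    have h2 : mult A ((σ z).1 : ℂ) = mult A (z.1 : ℂ) := (hA.conj_mem _ z.2.1).2
    rw [Function.Involutive.coe_toPerm, h1, h2]
    simp
  have hinj : Function.Injective
      fun z : {z : closedStrip // (z : ℂ) ∈ spectrum A ∧ ψ.1.1 z ≠ 0} =>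
        (ULift.up ⟨z.1, z.2.1⟩ : SpecIndex.{w} A) := fun z w h =>
    Subtype.ext (Subtype.mk.inj (ULift.up.inj h))
  have hre : weightedForm (specWeight (A := A))
      ((fun i : SpecIndex.{w} A => ψ.1.1 i.down.1 ^ n) • supportIndicator ψ)
      (supportIndicator ψ) = T.re := by
    refine HasSum.unique ((hinj.hasSum_iff fun i hi => ?_).2 (hasSum_weightedForm _ _ _))
      ((Complex.hasSum_re hsum).congr_fun fun z => ?_)
    · have : ψ.1.1 i.down.1 = 0 := by
        by_contra h0
        exact hi ⟨⟨i.down.1, i.down.2, h0⟩, rfl⟩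
      simp [supportIndicator_apply, this]
    · simp [supportIndicator_apply, z.2.2, specWeight]
  rw [hre, Complex.conj_eq_iff_re.1 hreal]
  exact hsum

theorem IsAdmissible.isIntersectionTheory_model (hA : IsAdmissible A) {φ : ℝ → holAlg A}
    (hφ : ∀ Y, 0 < Y → IsCutoff A Y (φ Y)) (hRH : RiemannHypothesisFor A) :
    IsIntersectionTheory A φ (hyperbolicSum (weightedForm (specWeight.{w} (A := A))))
      (1, 0, 0) (0, 1, 0) (1, 1, 0) (finiteSupportAlg A) (fun ψ => (1, 1, supportIndicator ψ))
      ((modelHom : holAlg A →ₐ[ℝ] _).toNonUnitalAlgHom.comp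
        (NonUnitalSubalgebraClass.subtype (finiteSupportAlg A))) := by
  set Φ := ((modelHom : holAlg A →ₐ[ℝ] Module.End ℝ (ModelSpace.{w} A)).toNonUnitalAlgHom.comp
        (NonUnitalSubalgebraClass.subtype (finiteSupportAlg A))) with hΦ
  have hpow : ∀ (ψ : finiteSupportAlg A) (n : ℕ), (Φ ψ ^ n) (1, 1, supportIndicator ψ)
      = ((ψ.1.1 pt1).re ^ n, (ψ.1.1 pt0).re ^ n,
      (fun i : SpecIndex.{w} A => ψ.1.1 i.down.1 ^ n) • supportIndicator ψ) :=
    fun ψ n => modelHom_pow_apply ψ.1 n _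
  have hmem : ∀ Y : ℝ, 0 < Y → φ Y ∈ finiteSupportAlg A := fun Y hY =>
    hA.finite_support_isCutoff (hφ Y hY)
  have hone : ∀ Y, 0 < Y → ((φ Y).1 pt0).re = 1 := fun Y hY => by
    rw [(hφ Y hY).at_zero, Complex.one_re]
  -- The only use of the Riemann Hypothesis: on the support `|φ(s)|² = q^(2 Re s) = q`, so `Φ`
  -- scales the form on the spectral part of `vδ` by exactly `q`.
  have hnormSq : ∀ (Y : ℝ) (hY : 0 < Y) (n : ℕ), weightedForm (specWeight (A := A))
      ((fun i : SpecIndex.{w} A => (φ Y).1 i.down.1 ^ n) • supportIndicator ⟨φ Y, hmem Y hY⟩)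
      ((fun i : SpecIndex.{w} A => (φ Y).1 i.down.1 ^ n) • supportIndicator ⟨φ Y, hmem Y hY⟩)
      = qTilde (φ Y) ^ n * weightedForm (specWeight (A := A))
        (supportIndicator ⟨φ Y, hmem Y hY⟩) (supportIndicator ⟨φ Y, hmem Y hY⟩) := by
    intro Y hY n
    refine (hasSum_weightedForm _ _ _).unique
      (((hasSum_weightedForm _ _ _).mul_left _).congr_fun fun i => ?_)
    by_cases h0 : (φ Y).1 i.down.1 = 0
    · simp [supportIndicator_apply, h0]
    · have hc := hφ Y hY
      have hnorm := hc.norm_eq i.down.2 (hc.low_of_ne_zero i.down.2 h0)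
      rw [hRH _ i.down.2, ← Real.sqrt_eq_rpow] at hnorm
      have hsq : ((φ Y).1 i.down.1 ^ n * starRingEnd ℂ ((φ Y).1 i.down.1 ^ n)).re
          = qTilde (φ Y) ^ n := by
        rw [Complex.mul_conj, Complex.ofReal_re, Complex.normSq_eq_norm_sq, norm_pow, hnorm,
          ← pow_mul, mul_comm, pow_mul, Real.sq_sqrt hc.q_pos.le]
      rw [Finsupp.coe_pointwise_smul, Pi.smul_apply', smul_eq_mul, supportIndicator_apply,
        if_neg h0, mul_one, hsq]
      simp
      ring
  exact
    { v01_ne := by simp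
      v10_ne := by simp
      ha_ne := by simp
      map_one := fun _ => _root_.map_one (modelHom (A := A))
      mem_dom := hmem
      int1a := by simp [hyperbolicSum_apply]
      int1b := by simp [hyperbolicSum_apply]
      int1c := by simp [hyperbolicSum_apply]
      int1d := fun Y hY n => by
        rw [hpow]
        simp [hyperbolicSum_apply, hone Y hY]
      int1e := fun Y hY => (isBigO_refl _ _).congr_left fun n => by
        rw [hpow]
        simp [hyperbolicSum_apply, qTilde]
      int1f := fun Y hY => by
        refine ((isBigO_refl (fun n : ℕ => qTilde (φ Y) ^ n) atTop).const_mul_left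
          (2 - weightedForm (specWeight (A := A)) (supportIndicator ⟨φ Y, hmem Y hY⟩)
            (supportIndicator ⟨φ Y, hmem Y hY⟩))).congr_left fun n => ?_
        rw [hpow, hyperbolicSum_apply, hnormSq Y hY, hone Y hY, qTilde]
        ring
      int1g := fun x y => by
        rw [hyperbolicSum_apply, hyperbolicSum_apply, weightedForm_comm]
        ring
      int2 := hyperbolicSum_self_nonpos
        (weightedForm_self_nonneg fun i => Nat.cast_nonneg _)
      int3 := fun ψ n => by
        rw [pairing_hyperbolicSum, hpow]
        exact hA.hasTracePow_weightedForm ψ n }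

end Operators

end

end AbsInt

theorem theorem3p5 {H : Type u} [NormedAddCommGroup H] [InnerProductSpace ℂ H]
    [CompleteSpace H] [TopologicalSpace.SeparableSpace H]
    (A : H →ₗ.[ℂ] H) (hA : AbsInt.IsAdmissible A) :
    (∃ φ : ℝ → AbsInt.holAlg A, ∀ Y : ℝ, 0 < Y → AbsInt.IsCutoff A Y (φ Y)) ∧
    ∀ φ : ℝ → AbsInt.holAlg A, (∀ Y : ℝ, 0 < Y → AbsInt.IsCutoff A Y (φ Y)) →
      (AbsInt.RiemannHypothesisFor A ↔
        ∃ (V : Type w) (_ : AddCommGroup V) (_ : Module ℝ V) (β : LinearMap.BilinForm ℝ V)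
          (v01 v10 ha : V) (D : NonUnitalSubalgebra ℝ (AbsInt.holAlg A)) (vδ : D → V)
          (Φ : D →ₙₐ[ℝ] Module.End ℝ V),
          AbsInt.IsIntersectionTheory A φ β v01 v10 ha D vδ Φ) := by
  refine ⟨?_, fun φ hφ => ⟨fun hRH => ?_, ?_⟩⟩
  · choose! φ hφ using fun (Y : ℝ) (hY : 0 < Y) => hA.exists_isCutoff hY
    exact ⟨φ, hφ⟩
  · exact ⟨AbsInt.ModelSpace.{w} A, inferInstance, inferInstance, _, _, _, _, _, _, _,
      hA.isIntersectionTheory_model hφ hRH⟩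
  · rintro ⟨V, _, _, β, v01, v10, ha, D, vδ, Φ, h⟩
    exact h.riemannHypothesisFor hA hφ
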